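/- For integers $3\le k<n$ let $C_nC_k$ be the simple graph obtained from the cycle with vertices $0,1,\dots,n-1$ (in cyclic order) by adding the edge $\{0,k-1\}$, so that this edge closes a $k$-cycle $0,1,\dots,k-1$. For a finite graph $G$ let $\pi_i=\deg(i)/(2|E(G)|)$. The non-backtracking random walk on $G$ started at $i$ has $X_0=i$, chooses $X_1$ uniformly among the neighbours of $i$, and for $t\ge 1$ chooses $X_{t+1}$ uniformly among the neighbours of $X_t$ other than $X_{t-1}$. Let $M^{(nb)}_v$ be the matrix whose $(i,j)$ entry is the expected value of the first time $t\ge 0$ with $X_t=j$ for the walk started at $i$ (so the diagonal entries are $0$). For all integers $3\le k<n$ and $G=C_nC_k$, all these expected hitting times are finite and \[ \pi^\top M^{(nb)}_v\pi=\frac{10n^3+n^2(3k+6)-n(3k^2-9k+22)-3k^2+6k-15}{18(n+1)^2}. \] Furthermore, for fixed $n$, the value of $\pi^\top M^{(nb)}_v\pi$ for $C_nC_k$ is strictly increasing in the integer $k$ on the range $3\le k\le n/2$. -/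

import Mathlib

open MeasureTheory ProbabilityTheory
open scoped ENNReal Matrix

noncomputable section

/-- The vertices to which a non-backtracking walk may move when its history up to time `m`
is `x`: every neighbour of the starting vertex if `m = 0`, and otherwise every neighbour of the
current vertex except the vertex occupied one step before. -/
def nbChoices {V : Type*} [Fintype V] [DecidableEq V] (G : SimpleGraph V) [DecidableRel G.Adj] :
    (m : ℕ) → ((i : Finset.Iic m) → V) → Finset V
  | 0, x => G.neighborFinset (x ⟨0, Finset.mem_Iic.2 le_rfl⟩)
  | m + 1, x => (G.neighborFinset (x ⟨m + 1, Finset.mem_Iic.2 le_rfl⟩)).erase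
      (x ⟨m, Finset.mem_Iic.2 (Nat.le_succ m)⟩)

/-- The law of the next vertex given the history: uniform on the admissible vertices.
(If there is none, which cannot happen when all degrees are at least two, the walk stays put.) -/
def nbStep {V : Type*} [Fintype V] [DecidableEq V] (G : SimpleGraph V) [DecidableRel G.Adj]
    (m : ℕ) (x : (i : Finset.Iic m) → V) : PMF V :=
  if h : (nbChoices G m x).Nonempty then PMF.uniformOfFinset (nbChoices G m x) h
  else PMF.pure (x ⟨m, Finset.mem_Iic.2 le_rfl⟩)

/-- `nbStep` as a Markov kernel from histories to vertices. -/
def nbKernel {V : Type*} [Fintype V] [DecidableEq V] [MeasurableSpace V]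
    [MeasurableSingletonClass V] (G : SimpleGraph V) [DecidableRel G.Adj] (m : ℕ) :
    Kernel ((i : Finset.Iic m) → V) V :=
  Kernel.ofFunOfCountable fun x => (nbStep G m x).toMeasure

instance nbKernel_isMarkovKernel {V : Type*} [Fintype V] [DecidableEq V] [MeasurableSpace V]
    [MeasurableSingletonClass V] (G : SimpleGraph V) [DecidableRel G.Adj] (m : ℕ) :
    IsMarkovKernel (nbKernel G m) :=
  ⟨fun x => by
    change IsProbabilityMeasure (nbStep G m x).toMeasure
    infer_instance⟩

/-- The law, on the space of trajectories `ℕ → V`, of the non-backtracking random walk on `G`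
started at the vertex `i`. -/
def nbWalk {V : Type*} [Fintype V] [DecidableEq V] [MeasurableSpace V]
    [MeasurableSingletonClass V] (G : SimpleGraph V) [DecidableRel G.Adj] (i : V) :
    Measure (ℕ → V) :=
  Kernel.traj (X := fun _ => V) (nbKernel G) 0 fun _ => i

/-- The first time at which the trajectory `ω` is at `j` (`∞` if this never happens). -/
def firstHit {V : Type*} (j : V) (ω : ℕ → V) : ℝ≥0∞ :=
  ⨅ (t : ℕ) (_ : ω t = j), (t : ℝ≥0∞)

/-- The expected time at which the non-backtracking random walk started at `i` first hits `j`. -/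
def nbHittingTime {V : Type*} [Fintype V] [DecidableEq V] [MeasurableSpace V]
    [MeasurableSingletonClass V] (G : SimpleGraph V) [DecidableRel G.Adj] (i j : V) : ℝ≥0∞ :=
  ∫⁻ ω, firstHit j ω ∂(nbWalk G i)

/-- The matrix of non-backtracking first hitting times between vertices. -/
def nbHittingMatrix {V : Type*} [Fintype V] [DecidableEq V] [MeasurableSpace V]
    [MeasurableSingletonClass V] (G : SimpleGraph V) [DecidableRel G.Adj] : Matrix V V ℝ :=
  Matrix.of fun i j => if i = j then 0 else (nbHittingTime G i j).toReal

/-- The stationary distribution `π i = deg i / (2 |E(G)|)`. -/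
def statDist {V : Type*} [Fintype V] [DecidableEq V] (G : SimpleGraph V) [DecidableRel G.Adj] :
    V → ℝ :=
  fun i => (G.degree i : ℝ) / (2 * (G.edgeFinset.card : ℝ))

/-- The first hitting time Kemeny's constant `πᵀ M π` of the non-backtracking random walk. -/
def nbKemeny {V : Type*} [Fintype V] [DecidableEq V] [MeasurableSpace V]
    [MeasurableSingletonClass V] (G : SimpleGraph V) [DecidableRel G.Adj] : ℝ :=
  statDist G ⬝ᵥ (nbHittingMatrix G *ᵥ statDist G)

/-- The cycle `0, 1, …, n - 1` together with the edge joining `0` and `k - 1`, which closes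
the `k`-cycle `0, 1, …, k - 1`. -/
def cycleChord (n k : ℕ) : SimpleGraph (Fin n) :=
  SimpleGraph.cycleGraph n ⊔
    SimpleGraph.fromRel fun a b : Fin n => (a : ℕ) = 0 ∧ (b : ℕ) + 1 = k

instance cycleChord_decidableRel (n k : ℕ) : DecidableRel (cycleChord n k).Adj :=
  inferInstanceAs (DecidableRel (SimpleGraph.cycleGraph n ⊔
    SimpleGraph.fromRel fun a b : Fin n => (a : ℕ) = 0 ∧ (b : ℕ) + 1 = k).Adj)

end

/-! Put `a = k - 1`. The graph is a theta graph: the branch vertices `0` and `a` are joined by paths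
of lengths `a`, `n - a` and `1`. All other vertices have degree two, where a non-backtracking walk
has no choice. Hence, for a fixed target `j`, the expected time to reach `j` after committing to a
directed edge is affine along each stretch between branch vertices and target. It is determined by
six numbers, the expected remaining times on arriving at either branch vertex through each of the
three paths, and these satisfy a small linear system solved here in closed form.

That these numbers really are hitting times is a verification principle
(`nbHittingTime_of_firstStep`): any finite nonnegative solution of the first-step equations on
directed edges gives the expected hitting times, so neither existence nor uniqueness needs a
separate argument. It also yields finiteness.

The principle gives `deg i * M i j` directly as a sum over the edges leaving `i`, so the weights in
`π` cancel the averaging. Each column sum is then a sum of arithmetic progressions (`columnValue`),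
quadratic in `j` inside each path, and summing over `j` with weight `deg j` gives the formula
(`nbKemeny_cycleChord`). Monotonicity follows by factoring the difference of two values. -/

/-- Tail-sum form of the hitting time; it lets the expectation be computed from survival
probabilities. -/
lemma firstHit_eq_tsum {V : Type*} [DecidableEq V] (j : V) (ω : ℕ → V) :
    firstHit j ω = ∑' t : ℕ, if ∀ s ≤ t, ω s ≠ j then (1 : ℝ≥0∞) else 0 := by
  by_cases h : ∃ t, ω t = j
  · have hA : ∀ t, (∀ s ≤ t, ω s ≠ j) ↔ t ∈ Finset.range (Nat.find h) := by
      intro t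
      rw [Finset.mem_range, Nat.lt_find_iff]
    simp only [hA]
    rw [tsum_eq_sum (s := Finset.range (Nat.find h)) (fun t ht => if_neg ht)]
    rw [Finset.sum_congr rfl (fun t ht => if_pos ht)]
    simp only [Finset.sum_const, Finset.card_range, nsmul_eq_mul, mul_one]
    refine le_antisymm (iInf₂_le (f := fun (t : ℕ) (_ : ω t = j) => (t : ℝ≥0∞)) _ (Nat.find_spec h)) (le_iInf₂ fun t ht => ?_)
    exact_mod_cast Nat.find_min' h ht
  · push Not at h
    have : ∀ t : ℕ, (∀ s ≤ t, ω s ≠ j) := fun t s _ => h s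
    simp [firstHit, h]

/-! ### Non-backtracking walks on a finite graph of minimum degree two -/

section General

variable {V : Type*} [Fintype V] [DecidableEq V] {G : SimpleGraph V} [DecidableRel G.Adj]

lemma sum_mul_nbStep {b : ℕ} {x : (s : Finset.Iic b) → V} (hx : (nbChoices G b x).Nonempty)
    (f : V → ℝ≥0∞) :
    ∑ y, f y * nbStep G b x y =
      (∑ y ∈ nbChoices G b x, f y) * ((nbChoices G b x).card : ℝ≥0∞)⁻¹ := by
  rw [nbStep, dif_pos hx, Finset.sum_mul]
  simp only [PMF.uniformOfFinset_apply, mul_ite, mul_zero]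
  rw [← Finset.sum_filter]
  simp

lemma nbChoices_nonempty (hG : ∀ v, 2 ≤ G.degree v) (b : ℕ) (x : (s : Finset.Iic b) → V) :
    (nbChoices G b x).Nonempty := by
  cases b with
  | zero =>
    rw [← Finset.card_pos]
    have := hG (x ⟨0, Finset.mem_Iic.2 le_rfl⟩)
    rw [← SimpleGraph.card_neighborFinset_eq_degree] at this
    exact lt_of_lt_of_le (by norm_num) this
  | succ m =>
    rw [← Finset.card_pos]
    have := hG (x ⟨m + 1, Finset.mem_Iic.2 le_rfl⟩)
    rw [← SimpleGraph.card_neighborFinset_eq_degree] at this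
    have h2 := Finset.pred_card_le_card_erase
      (s := G.neighborFinset (x ⟨m + 1, Finset.mem_Iic.2 le_rfl⟩))
      (a := x ⟨m, Finset.mem_Iic.2 (Nat.le_succ m)⟩)
    change 0 < (Finset.erase _ _).card
    omega

lemma nbChoices_subset (b : ℕ) (x : (s : Finset.Iic b) → V) :
    nbChoices G b x ⊆ G.neighborFinset (x ⟨b, Finset.mem_Iic.2 le_rfl⟩) := by
  cases b with
  | zero => exact subset_rfl
  | succ m => exact Finset.erase_subset _ _

variable [MeasurableSpace V] [MeasurableSingletonClass V]

variable (G) in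

instance nbWalk_isProbabilityMeasure (i : V) : IsProbabilityMeasure (nbWalk G i) := by
  unfold nbWalk; infer_instance

variable (G) in
-- The one-step Markov property in integrated form: the joint law of the history up to `b` and the
-- next vertex is the composition-product of the law of the history with the step kernel. Histories
-- range over a finite type, so measurability in them is automatic.
lemma lintegral_nbWalk_step (i : V) (b : ℕ) (f : ((s : Finset.Iic b) → V) → V → ℝ≥0∞) :
    ∫⁻ ω, f (Preorder.frestrictLe (π := fun _ => V) b ω) (ω (b + 1)) ∂(nbWalk G i) =
      ∫⁻ ω, ∑ y, f (Preorder.frestrictLe (π := fun _ => V) b ω) y *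
        nbStep G b (Preorder.frestrictLe (π := fun _ => V) b ω) y ∂(nbWalk G i) := by
  have hm : ∀ g : ((s : Finset.Iic b) → V) → ℝ≥0∞, Measurable g := fun g => measurable_of_countable g
  have hm2 : Measurable (fun p : ((s : Finset.Iic b) → V) × V => f p.1 p.2) :=
    measurable_of_countable _
  have h1 : ∫⁻ ω, f (Preorder.frestrictLe (π := fun _ => V) b ω) (ω (b + 1)) ∂(nbWalk G i) =
      ∫⁻ p, f p.1 p.2 ∂((nbWalk G i).map
        (fun x ↦ (Preorder.frestrictLe (π := fun _ => V) b x, x (b + 1)))) := by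
    rw [lintegral_map hm2 (by fun_prop)]
  rw [h1, nbWalk, ← Kernel.partialTraj_compProd_eq_map_traj (Nat.zero_le b),
    Measure.lintegral_compProd hm2, ← Kernel.traj_map_frestrictLe_apply,
    lintegral_map (hm _) (by fun_prop)]
  refine lintegral_congr fun ω => ?_
  rw [lintegral_fintype]
  refine Finset.sum_congr rfl fun y _ => ?_
  congr 1
  exact PMF.toMeasure_apply_singleton _ _ (measurableSet_singleton y)

variable (G) in
lemma nbWalk_ae_zero (i : V) : ∀ᵐ ω ∂(nbWalk G i), ω 0 = i := by
  have h := Kernel.traj_map_frestrictLe_apply (X := fun _ => V) (κ := nbKernel G) 0 0 (fun _ => i)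
  rw [Kernel.partialTraj_self, Kernel.id_apply] at h
  have h2 : ∀ᵐ x ∂((Kernel.traj (X := fun _ => V) (nbKernel G) 0 (fun _ => i)).map
      (Preorder.frestrictLe 0)), x ⟨0, Finset.mem_Iic.2 le_rfl⟩ = i := by
    rw [h, ae_dirac_eq]; rfl
  exact ae_of_ae_map (by fun_prop) h2

lemma nbWalk_ae_adj (hG : ∀ v, 2 ≤ G.degree v) (i : V) (b : ℕ) :
    ∀ᵐ ω ∂(nbWalk G i), G.Adj (ω b) (ω (b + 1)) := by
  -- The test function is the indicator of an illegal move, which the step law never charges.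
  have h := lintegral_nbWalk_step G i b
    (fun x y => if G.Adj (x ⟨b, Finset.mem_Iic.2 le_rfl⟩) y then 0 else 1)
  have h0 : ∀ x : (s : Finset.Iic b) → V,
      ∑ y, (if G.Adj (x ⟨b, Finset.mem_Iic.2 le_rfl⟩) y then (0 : ℝ≥0∞) else 1) * nbStep G b x y
        = 0 := by
    intro x
    rw [sum_mul_nbStep (nbChoices_nonempty hG b x), Finset.sum_eq_zero, zero_mul]
    intro y hy
    rw [if_pos]
    simpa using nbChoices_subset b x hy
  simp only [h0, lintegral_zero] at h
  rw [lintegral_eq_zero_iff'] at h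
  · filter_upwards [h] with ω hω
    by_contra hc
    have : (if G.Adj (ω b) (ω (b + 1)) then (0 : ℝ≥0∞) else 1) = 0 := hω
    rw [if_neg hc] at this
    exact one_ne_zero this
  · have : Measurable (fun p : V × V => if G.Adj p.1 p.2 then (0 : ℝ≥0∞) else 1) :=
      measurable_of_countable _
    have h2 : Measurable fun ω : ℕ → V => (ω b, ω (b + 1)) := by fun_prop
    exact (this.comp h2).aemeasurable

lemma measurable_survival (j : V) (t : ℕ) :
    Measurable fun ω : ℕ → V => if ∀ s ≤ t, ω s ≠ j then (1 : ℝ≥0∞) else 0 := by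
  have h1 : Measurable fun x : ((s : Finset.Iic t) → V) =>
    if ∀ s, x s ≠ j then (1 : ℝ≥0∞) else 0 := measurable_of_countable _
  have h2 := h1.comp (Preorder.measurable_frestrictLe (X := fun _ => V) t)
  convert h2 using 2 with ω
  simp only [Function.comp_apply, Preorder.frestrictLe_apply, Subtype.forall, Finset.mem_Iic]
  congr

/-- `E[h(X_t, X_{t+1}); T > t]` decreases by `P(T > t)` when `t` increases by one. -/
lemma lintegral_survival_step (hG : ∀ v, 2 ≤ G.degree v) (i j : V) (H : V → V → ℝ≥0∞)
    (hj : ∀ u, G.Adj u j → H u j = 1)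
    (hH : ∀ u v, G.Adj u v → v ≠ j → H u v = 1 +
      (∑ w ∈ (G.neighborFinset v).erase u, H v w) *
        (((G.neighborFinset v).erase u).card : ℝ≥0∞)⁻¹) (t : ℕ) :
    ∫⁻ ω, (if ∀ s ≤ t, ω s ≠ j then H (ω t) (ω (t + 1)) else 0) ∂(nbWalk G i) =
      ∫⁻ ω, (if ∀ s ≤ t, ω s ≠ j then 1 else 0) ∂(nbWalk G i) +
      ∫⁻ ω, (if ∀ s ≤ t + 1, ω s ≠ j then H (ω (t + 1)) (ω (t + 1 + 1)) else 0)
        ∂(nbWalk G i) := by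
  -- Averaging over the move out of `ω (t + 1)` turns the last integral into the sum in `hH`; the
  -- identity then holds trajectory by trajectory.
  have h := lintegral_nbWalk_step G i (t + 1) (fun x y =>
    if ∀ s : Finset.Iic (t + 1), x s ≠ j then
      H (x ⟨t + 1, Finset.mem_Iic.2 le_rfl⟩) y else 0)
  have hA : ∀ ω : ℕ → V, (∀ s : Finset.Iic (t + 1),
      Preorder.frestrictLe (π := fun _ => V) (t + 1) ω s ≠ j) ↔ ∀ s ≤ t + 1, ω s ≠ j := by
    intro ω
    simp [Preorder.frestrictLe]
  simp only [hA] at h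
  refine Eq.trans ?_ (congrArg (_ + ·) h.symm)
  rw [← lintegral_add_left (measurable_survival j t)]
  refine lintegral_congr_ae ?_
  filter_upwards [nbWalk_ae_adj hG i t] with ω hω
  by_cases h1 : ∀ s ≤ t, ω s ≠ j
  · rw [if_pos h1, if_pos h1]
    by_cases h2 : ω (t + 1) = j
    · have h3 : ¬ ∀ s ≤ t + 1, ω s ≠ j := fun h => h _ le_rfl h2
      simp only [if_neg h3, zero_mul, Finset.sum_const_zero, add_zero]
      rw [h2] at hω ⊢
      exact hj _ hω
    · have h3 : ∀ s ≤ t + 1, ω s ≠ j := by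
        intro s hs
        rcases Nat.le_succ_iff.1 hs with hs | rfl
        · exact h1 s hs
        · exact h2
      simp only [if_pos h3]
      rw [sum_mul_nbStep (nbChoices_nonempty hG _ _), hH _ _ hω h2]
      rfl
  · have h3 : ¬ ∀ s ≤ t + 1, ω s ≠ j := fun h => h1 fun s hs => h s (Nat.le_succ_of_le hs)
    simp [if_neg h1, if_neg h3]

lemma nbHittingTime_self (i : V) : nbHittingTime G i i = 0 := by
  rw [nbHittingTime, ← lintegral_zero (μ := nbWalk G i)]
  refine lintegral_congr_ae ?_
  filter_upwards [nbWalk_ae_zero G i] with ω hω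
  exact le_antisymm ((iInf₂_le (f := fun (t : ℕ) (_ : ω t = i) => (t : ℝ≥0∞)) 0 hω).trans (by simp)) zero_le

/-- With `p t = P(T > t)` and `a t = E[H(X_t, X_{t+1}); T > t]`, the first-step equations say `a t =
p t + a (t + 1)`. Telescoping gives `a 0 = ∑ p t`, the expected hitting time, once `a t → 0`. -/
lemma nbHittingTime_eq_of_ennreal (hG : ∀ v, 2 ≤ G.degree v) {i j : V} (hij : i ≠ j)
    (H : V → V → ℝ≥0∞) (hfin : ∀ u v, H u v ≠ ∞) (hj : ∀ u, G.Adj u j → H u j = 1)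
    (hH : ∀ u v, G.Adj u v → v ≠ j → H u v = 1 +
      (∑ w ∈ (G.neighborFinset v).erase u, H v w) *
        (((G.neighborFinset v).erase u).card : ℝ≥0∞)⁻¹) :
    nbHittingTime G i j =
      (∑ w ∈ G.neighborFinset i, H i w) * (G.degree i : ℝ≥0∞)⁻¹ := by
  set a : ℕ → ℝ≥0∞ := fun t =>
    ∫⁻ ω, (if ∀ s ≤ t, ω s ≠ j then H (ω t) (ω (t + 1)) else 0) ∂(nbWalk G i) with ha
  set p : ℕ → ℝ≥0∞ := fun t =>
    ∫⁻ ω, (if ∀ s ≤ t, ω s ≠ j then 1 else 0) ∂(nbWalk G i) with hp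
  have hstep : ∀ t, a t = p t + a (t + 1) := lintegral_survival_step hG i j H hj hH
  have hT : nbHittingTime G i j = ∑' t, p t := by
    rw [nbHittingTime, hp, ← lintegral_tsum fun t => (measurable_survival j t).aemeasurable]
    exact lintegral_congr fun ω => firstHit_eq_tsum j ω
  have hsum : ∀ N, a 0 = ∑ t ∈ Finset.range N, p t + a N := by
    intro N
    induction N with
    | zero => simp
    | succ N ih => rw [Finset.sum_range_succ, add_assoc, ← hstep, ← ih]
  have ha0 : a 0 = (∑ w ∈ G.neighborFinset i, H i w) * (G.degree i : ℝ≥0∞)⁻¹ := by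
    have h := lintegral_nbWalk_step G i 0 (fun x y =>
      if x ⟨0, Finset.mem_Iic.2 le_rfl⟩ ≠ j then H (x ⟨0, Finset.mem_Iic.2 le_rfl⟩) y else 0)
    have h1 : a 0 = ∫⁻ ω, (if ω 0 ≠ j then H (ω 0) (ω (0 + 1)) else 0) ∂(nbWalk G i) := by
      simp [ha]
    rw [h1]
    refine h.trans ?_
    have h2 : ∀ᵐ ω ∂(nbWalk G i), (∑ y, (if ω 0 ≠ j then H (ω 0) y else 0) *
        nbStep G 0 (Preorder.frestrictLe (π := fun _ => V) 0 ω) y) =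
        (∑ w ∈ G.neighborFinset i, H i w) * (G.degree i : ℝ≥0∞)⁻¹ := by
      filter_upwards [nbWalk_ae_zero G i] with ω hω
      rw [sum_mul_nbStep (nbChoices_nonempty hG _ _)]
      have h3 : nbChoices G 0 (Preorder.frestrictLe (π := fun _ => V) 0 ω) =
        G.neighborFinset i := congrArg (fun v => G.neighborFinset v) hω
      rw [h3, hω, SimpleGraph.card_neighborFinset_eq_degree]
      simp [hij]
    refine (lintegral_congr_ae h2).trans ?_
    simp
  have hafin : a 0 ≠ ∞ := by
    rw [ha0]
    refine ENNReal.mul_ne_top (ENNReal.sum_ne_top.2 fun w _ => hfin i w) ?_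
    have := hG i
    simp only [ne_eq, ENNReal.inv_eq_top, Nat.cast_eq_zero]
    omega
  -- The partial sums of `p` are bounded by the finite `a 0`, so `p t → 0`; as `H` is bounded by a
  -- constant `C`, also `a t ≤ C * p t → 0`.
  have hpfin : ∑' t, p t ≠ ∞ := by
    refine ne_top_of_le_ne_top hafin (ENNReal.tsum_le_of_sum_range_le fun N => ?_)
    rw [hsum N]
    exact le_self_add
  have hp0 := ENNReal.tendsto_atTop_zero_of_tsum_ne_top hpfin
  set C : ℝ≥0∞ := ∑ u, ∑ v, H u v with hC
  have hCfin : C ≠ ∞ := ENNReal.sum_ne_top.2 fun u _ => ENNReal.sum_ne_top.2 fun v _ => hfin u v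
  have hHC : ∀ u v, H u v ≤ C := fun u v =>
    (Finset.single_le_sum (f := fun v => H u v) (fun _ _ => zero_le) (Finset.mem_univ v)).trans
      (Finset.single_le_sum (f := fun u => ∑ v, H u v) (fun _ _ => zero_le)
        (Finset.mem_univ u))
  have haC : ∀ t, a t ≤ C * p t := by
    intro t
    rw [hp, ← lintegral_const_mul _ (measurable_survival j t)]
    refine lintegral_mono fun ω => ?_
    dsimp only
    split_ifs
    · simpa using hHC _ _
    · simp
  have ha0' : Filter.Tendsto a Filter.atTop (nhds 0) := by
    have h := ENNReal.Tendsto.const_mul (a := C) hp0 (Or.inr hCfin)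
    rw [mul_zero] at h
    exact tendsto_of_tendsto_of_tendsto_of_le_of_le tendsto_const_nhds h (fun _ => zero_le) haC
  have hlim := (ENNReal.tendsto_nat_tsum p).add ha0'
  simp only [← hsum, add_zero] at hlim
  rw [hT, ← ha0]
  exact tendsto_nhds_unique hlim tendsto_const_nhds

/-- Verification principle: nonnegative solutions of the first-step equations on directed edges
compute the hitting times. Here `h u v` is the expected time to reach `j` for a walk about to
traverse the directed edge from `u` to `v`. -/
theorem nbHittingTime_of_firstStep (hG : ∀ v, 2 ≤ G.degree v) {i j : V} (hij : i ≠ j)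
    (h : V → V → ℝ) (hnn : ∀ u v, 0 ≤ h u v) (hj : ∀ u, G.Adj u j → h u j = 1)
    (hh : ∀ u v, G.Adj u v → v ≠ j →
      ∑ w ∈ G.neighborFinset v, h v w - h v u = (G.degree v - 1) * (h u v - 1)) :
    nbHittingTime G i j ≠ ∞ ∧
      G.degree i * (nbHittingTime G i j).toReal = ∑ w ∈ G.neighborFinset i, h i w := by
  have key := nbHittingTime_eq_of_ennreal hG hij (fun u v => ENNReal.ofReal (h u v))
    (fun _ _ => ENNReal.ofReal_ne_top) (fun u hu => by simp [hj u hu]) (by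
      intro u v huv hv
      have hu : u ∈ G.neighborFinset v := by simpa using huv.symm
      have hc : (((G.neighborFinset v).erase u).card : ℝ) = G.degree v - 1 := by
        rw [Finset.card_erase_of_mem hu, SimpleGraph.card_neighborFinset_eq_degree,
          Nat.cast_sub (by have := hG v; omega), Nat.cast_one]
      have hpos : (0 : ℝ) < ((G.neighborFinset v).erase u).card := by
        have : (2 : ℝ) ≤ G.degree v := by exact_mod_cast hG v
        rw [hc]; linarith
      have h1 := hh u v huv hv
      rw [← Finset.add_sum_erase _ _ hu, ← hc] at h1
      -- The hypothesis `hh` divided by `deg v - 1`, which is positive because every degree is at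
      -- least two.
      have h2 : h u v = 1 + (∑ w ∈ (G.neighborFinset v).erase u, h v w) *
          (((G.neighborFinset v).erase u).card : ℝ)⁻¹ := by
        field_simp
        linarith
      rw [h2, ENNReal.ofReal_add zero_le_one, ENNReal.ofReal_mul, ENNReal.ofReal_inv_of_pos hpos,
        ENNReal.ofReal_natCast, ENNReal.ofReal_one, ENNReal.ofReal_sum_of_nonneg]
      · exact fun w _ => hnn v w
      · exact Finset.sum_nonneg fun w _ => hnn v w
      · exact mul_nonneg (Finset.sum_nonneg fun w _ => hnn v w) (inv_nonneg.2 hpos.le))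
  have hd : (2 : ℝ) ≤ G.degree i := by exact_mod_cast hG i
  have hd0 : (0 : ℝ) < G.degree i := by linarith
  rw [← ENNReal.ofReal_sum_of_nonneg fun w _ => hnn i w, ← ENNReal.ofReal_natCast,
    ← ENNReal.ofReal_inv_of_pos hd0, ← ENNReal.ofReal_mul
      (Finset.sum_nonneg fun w _ => hnn i w)] at key
  rw [key]
  refine ⟨ENNReal.ofReal_ne_top, ?_⟩
  rw [ENNReal.toReal_ofReal (mul_nonneg (Finset.sum_nonneg fun w _ => hnn i w)
    (inv_nonneg.2 hd0.le))]
  field_simp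

end General

/-! ### The cycle with a chord: adjacency and degrees -/

section CycleChord

/-- The successor of `u` on the cycle `0, 1, …, n - 1`. -/
def cycleNext {n : ℕ} (u : Fin n) : Fin n :=
  ⟨if (u : ℕ) + 1 < n then u + 1 else 0, by split_ifs <;> omega⟩

/-- The predecessor of `u` on the cycle `0, 1, …, n - 1`. -/
def cyclePrev {n : ℕ} (u : Fin n) : Fin n :=
  ⟨if (u : ℕ) = 0 then n - 1 else u - 1, by split_ifs <;> omega⟩

variable {n a : ℕ}

lemma cycleNext_cyclePrev (u : Fin n) : cycleNext (cyclePrev u) = u := by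
  ext
  by_cases h : (u : ℕ) = 0
  · have : ¬ n - 1 + 1 < n := by omega
    simp only [cycleNext, cyclePrev, h, if_true, if_neg this]
  · have : (u : ℕ) - 1 + 1 < n := by omega
    simp only [cycleNext, cyclePrev, if_neg h, if_pos this]
    omega

lemma cyclePrev_cycleNext (u : Fin n) : cyclePrev (cycleNext u) = u := by
  ext
  by_cases h : (u : ℕ) + 1 < n
  · simp [cycleNext, cyclePrev, h]
  · simp only [cycleNext, cyclePrev, if_neg h, if_true]
    omega

lemma cycleGraph_adj_iff (hn : 3 ≤ n) (u v : Fin n) :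
    (SimpleGraph.cycleGraph n).Adj u v ↔ v = cycleNext u ∨ v = cyclePrev u := by
  rw [SimpleGraph.cycleGraph_adj', Fin.ext_iff, Fin.ext_iff]
  have h : ∀ x y : Fin n, (x - y).val = if y ≤ x then (x : ℕ) - y else n + x - y := by
    intro x y
    split_ifs with h
    · exact Fin.sub_val_of_le h
    · exact Fin.coe_sub_iff_lt.2 (not_le.1 h)
  simp only [h, cycleNext, cyclePrev, Fin.le_def]
  split_ifs <;> omega

lemma cycleChord_adj_iff (ha : 2 ≤ a) (han : a + 1 < n) (u v : Fin n) :
    (cycleChord n (a + 1)).Adj u v ↔ v = cycleNext u ∨ v = cyclePrev u ∨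
      ((u : ℕ) = 0 ∧ (v : ℕ) = a) ∨ ((u : ℕ) = a ∧ (v : ℕ) = 0) := by
  rw [cycleChord, SimpleGraph.sup_adj, cycleGraph_adj_iff (by omega), SimpleGraph.fromRel_adj,
    or_assoc, ne_eq, Fin.ext_iff (a := u)]
  omega

/-- The bounds on `a` keep the chord from coinciding with a cycle edge, so no neighbour is counted
twice. -/
lemma sum_neighborFinset_cycleChord (ha : 2 ≤ a) (han : a + 1 < n) (g : Fin n → ℝ)
    (v : Fin n) :
    ∑ w ∈ (cycleChord n (a + 1)).neighborFinset v, g w =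
      g (cycleNext v) + g (cyclePrev v) + (if (v : ℕ) = 0 then g ⟨a, by omega⟩ else 0) +
        (if (v : ℕ) = a then g ⟨0, by omega⟩ else 0) := by
  have hne : cycleNext v ≠ cyclePrev v := by
    rw [ne_eq, Fin.ext_iff]; simp only [cycleNext, cyclePrev]; split_ifs <;> omega
  by_cases h0 : (v : ℕ) = 0
  · have hN : (cycleChord n (a + 1)).neighborFinset v =
        {cycleNext v, cyclePrev v, ⟨a, by omega⟩} := by
      ext w
      simp only [SimpleGraph.mem_neighborFinset, cycleChord_adj_iff ha han, Finset.mem_insert,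
        Finset.mem_singleton, Fin.ext_iff]
      omega
    have h1 : cycleNext v ≠ ⟨a, by omega⟩ := by
      rw [ne_eq, Fin.ext_iff]; simp only [cycleNext]; split_ifs <;> omega
    have h2 : cyclePrev v ≠ ⟨a, by omega⟩ := by
      rw [ne_eq, Fin.ext_iff]; simp only [cyclePrev]; split_ifs; omega
    rw [hN, Finset.sum_insert (by simp [hne, h1]), Finset.sum_insert (by simp [h2]),
      Finset.sum_singleton, if_pos h0, if_neg (by omega)]
    ring
  · by_cases h1 : (v : ℕ) = a
    · have hN : (cycleChord n (a + 1)).neighborFinset v =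
          {cycleNext v, cyclePrev v, ⟨0, by omega⟩} := by
        ext w
        simp only [SimpleGraph.mem_neighborFinset, cycleChord_adj_iff ha han, Finset.mem_insert,
          Finset.mem_singleton, Fin.ext_iff]
        omega
      have h1' : cycleNext v ≠ ⟨0, by omega⟩ := by
        intro h
        have h' := congrArg Fin.val h
        simp only [cycleNext] at h'
        rw [if_pos (by omega)] at h'
        omega
      have h2 : cyclePrev v ≠ ⟨0, by omega⟩ := by
        rw [ne_eq, Fin.ext_iff]; simp only [cyclePrev]; split_ifs; omega
      rw [hN, Finset.sum_insert (by simp [hne, h1']), Finset.sum_insert (by simp [h2]),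
        Finset.sum_singleton, if_neg h0, if_pos h1]
      ring
    · have hN : (cycleChord n (a + 1)).neighborFinset v = {cycleNext v, cyclePrev v} := by
        ext w
        simp only [SimpleGraph.mem_neighborFinset, cycleChord_adj_iff ha han, Finset.mem_insert,
          Finset.mem_singleton, h0, h1, false_and, or_false]
      rw [hN, Finset.sum_pair hne, if_neg h0, if_neg h1]
      ring

lemma degree_cycleChord (ha : 2 ≤ a) (han : a + 1 < n) (v : Fin n) :
    ((cycleChord n (a + 1)).degree v : ℝ) =
      2 + (if (v : ℕ) = 0 then 1 else 0) + (if (v : ℕ) = a then 1 else 0) := by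
  have h := sum_neighborFinset_cycleChord ha han (fun _ => 1) v
  rw [Finset.sum_const, SimpleGraph.card_neighborFinset_eq_degree, nsmul_eq_mul, mul_one] at h
  rw [h]
  norm_num

lemma two_le_degree_cycleChord (ha : 2 ≤ a) (han : a + 1 < n) (v : Fin n) :
    2 ≤ (cycleChord n (a + 1)).degree v := by
  have h := degree_cycleChord ha han v
  have : (2 : ℝ) ≤ (cycleChord n (a + 1)).degree v := by
    rw [h]; split_ifs <;> norm_num
  exact_mod_cast this

lemma two_mul_card_edgeFinset_cycleChord (ha : 2 ≤ a) (han : a + 1 < n) :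
    2 * ((cycleChord n (a + 1)).edgeFinset.card : ℝ) = 2 * (n + 1) := by
  have h : ((∑ v, (cycleChord n (a + 1)).degree v : ℕ) : ℝ) =
      ((2 * (cycleChord n (a + 1)).edgeFinset.card : ℕ) : ℝ) :=
    congrArg _ (SimpleGraph.sum_degrees_eq_twice_card_edges _)
  push_cast at h
  rw [← h]
  simp only [degree_cycleChord ha han, Finset.sum_add_distrib]
  rw [Fin.sum_univ_eq_sum_range (fun i => if i = 0 then (1 : ℝ) else 0) n,
    Fin.sum_univ_eq_sum_range (fun i => if i = a then (1 : ℝ) else 0) n,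
    Finset.sum_ite_eq', Finset.sum_ite_eq', if_pos (by simp; omega), if_pos (by simp; omega)]
  simp
  ring

/-- Expected time to reach `j` for a walk about to leave `i` in the direction of increasing labels,
if the time is `xB` on arriving at `a` from `a - 1` and `yA` on arriving at `0` from `n - 1`. -/
def forwardTime (n a j : ℕ) (xB yA : ℝ) (i : ℕ) : ℝ :=
  if i < a then (if i < j ∧ j ≤ a then (j : ℝ) - i else a - i + xB)
  else (if i < j then (j : ℝ) - i else n - i + yA)

/-- Expected time to reach `j` for a walk about to leave `i` in the direction of decreasing labels,
where `1 ≤ i ≤ n` and `n` stands for the vertex `0`, if the time is `xA` on arriving at `0` from `1`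
and `yB` on arriving at `a` from `a + 1`. -/
def backwardTime (a j : ℕ) (xA yB : ℝ) (i : ℕ) : ℝ :=
  if i ≤ a then (if j < i then (i : ℝ) - j else i + xA)
  else (if a ≤ j ∧ j < i then (i : ℝ) - j else i - a + yB)

/-- The equations for the expected times `xA, yA, zA` (`xB, yB, zB`) to reach `j` on arriving at
the branch vertex `0` (`a`) through the path `0, 1, …, a`, through the path `a, …, n - 1, 0`, and
through the chord. -/
structure IsArrivalTimes (n a j : ℕ) (xA yA zA xB yB zB : ℝ) : Prop where
  nonneg : 0 ≤ xA ∧ 0 ≤ yA ∧ 0 ≤ zA ∧ 0 ≤ xB ∧ 0 ≤ yB ∧ 0 ≤ zB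
  eq_zero_left : j = 0 → xA = 0 ∧ yA = 0 ∧ zA = 0
  eq_zero_right : j = a → xB = 0 ∧ yB = 0 ∧ zB = 0
  left_eq : j ≠ 0 → 2 * xA = backwardTime a j xA yB n + (1 + zB) ∧
    2 * yA = forwardTime n a j xB yA 0 + (1 + zB) ∧
    2 * zA = forwardTime n a j xB yA 0 + backwardTime a j xA yB n
  right_eq : j ≠ a → 2 * xB = forwardTime n a j xB yA a + (1 + zA) ∧
    2 * yB = backwardTime a j xA yB a + (1 + zA) ∧
    2 * zB = forwardTime n a j xB yA a + backwardTime a j xA yB a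

/-- A function on directed edges given by its values on the cycle and on the chord. -/
def edgeTime (F G : ℕ → ℝ) (CA CB : ℝ) (u v : Fin n) : ℝ :=
  if v = cycleNext u then F u
  else if v = cyclePrev u then G (if (u : ℕ) = 0 then n else u)
  else if (u : ℕ) = 0 then CA else CB

lemma edgeTime_next (F G : ℕ → ℝ) (CA CB : ℝ) (u : Fin n) :
    edgeTime F G CA CB u (cycleNext u) = F u := if_pos rfl

lemma edgeTime_prev (hn : 3 ≤ n) (F G : ℕ → ℝ) (CA CB : ℝ) (u : Fin n) :
    edgeTime F G CA CB u (cyclePrev u) = G (if (u : ℕ) = 0 then n else u) := by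
  rw [edgeTime, if_neg, if_pos rfl]
  rw [Fin.ext_iff]; simp only [cycleNext, cyclePrev]; split_ifs <;> omega

lemma edgeTime_chord_left (ha : 2 ≤ a) (han : a + 1 < n) (F G : ℕ → ℝ) (CA CB : ℝ) {u v : Fin n}
    (hu : (u : ℕ) = 0) (hv : (v : ℕ) = a) : edgeTime F G CA CB u v = CA := by
  rw [edgeTime, if_neg, if_neg, if_pos hu] <;> rw [Fin.ext_iff] <;>
    simp only [cycleNext, cyclePrev] <;> split_ifs <;> omega

lemma edgeTime_chord_right (ha : 2 ≤ a) (han : a + 1 < n) (F G : ℕ → ℝ) (CA CB : ℝ) {u v : Fin n}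
    (hu : (u : ℕ) = a) (hv : (v : ℕ) = 0) : edgeTime F G CA CB u v = CB := by
  have h1 : v ≠ cycleNext u := by
    rw [ne_eq, Fin.ext_iff]; simp only [cycleNext]; split_ifs <;> omega
  have h2 : v ≠ cyclePrev u := by
    rw [ne_eq, Fin.ext_iff]; simp only [cyclePrev]; split_ifs <;> omega
  rw [edgeTime, if_neg h1, if_neg h2, if_neg (by omega)]

lemma sum_edgeTime (ha : 2 ≤ a) (han : a + 1 < n) (F G : ℕ → ℝ) (CA CB : ℝ) (v : Fin n) :
    ∑ w ∈ (cycleChord n (a + 1)).neighborFinset v, edgeTime F G CA CB v w =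
      F v + G (if (v : ℕ) = 0 then n else v) + (if (v : ℕ) = 0 then CA else 0) +
        (if (v : ℕ) = a then CB else 0) := by
  rw [sum_neighborFinset_cycleChord ha han, edgeTime_next, edgeTime_prev (by omega)]
  congr 1
  · congr 1
    split_ifs with h
    · exact edgeTime_chord_left ha han F G CA CB h rfl
    · rfl
  · split_ifs with h
    · exact edgeTime_chord_right ha han F G CA CB h rfl
    · rfl

/-! ### First-step equations along the paths and at the branch vertices -/

variable {j : ℕ} {xA yA zA xB yB zB : ℝ}

lemma forwardTime_nonneg {i : ℕ} (hi : i ≤ n) (hx : 0 ≤ xB) (hy : 0 ≤ yA) :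
    0 ≤ forwardTime n a j xB yA i := by
  have hi' : (i : ℝ) ≤ n := by exact_mod_cast hi
  unfold forwardTime
  split_ifs with h1 h2 h2
  · have : (i : ℝ) < j := by exact_mod_cast h2.1
    linarith
  · have : (i : ℝ) < a := by exact_mod_cast h1
    linarith
  · have : (i : ℝ) < j := by exact_mod_cast h2
    linarith
  · linarith

lemma backwardTime_nonneg {i : ℕ} (hx : 0 ≤ xA) (hy : 0 ≤ yB) :
    0 ≤ backwardTime a j xA yB i := by
  unfold backwardTime
  split_ifs with h1 h2 h2
  · have : (j : ℝ) < i := by exact_mod_cast h2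
    linarith
  · positivity
  · have : (j : ℝ) < i := by exact_mod_cast h2.2
    linarith
  · have : (a : ℝ) < i := by exact_mod_cast not_le.1 h1
    linarith

/-- Away from a branch vertex and the target the next move is forced and costs one step. -/
lemma forwardTime_succ {i : ℕ} (hia : i + 1 ≠ a) (hij : i + 1 ≠ j) :
    forwardTime n a j xB yA i = 1 + forwardTime n a j xB yA (i + 1) := by
  unfold forwardTime
  split_ifs <;> first | omega | (push_cast; ring)

lemma backwardTime_succ {i : ℕ} (hia : i ≠ a) (hij : i ≠ j) :
    backwardTime a j xA yB (i + 1) = 1 + backwardTime a j xA yB i := by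
  unfold backwardTime
  split_ifs <;> first | omega | (push_cast; ring)

lemma forwardTime_last (han : a < n) (hj : j < n) :
    forwardTime n a j xB yA (n - 1) = 1 + yA := by
  unfold forwardTime
  rw [if_neg (by omega), if_neg (by omega), Nat.cast_sub (by omega)]
  push_cast; ring

lemma forwardTime_before_branch (ha : 0 < a) (hj : j ≠ a) :
    forwardTime n a j xB yA (a - 1) = 1 + xB := by
  unfold forwardTime
  rw [if_pos (by omega), if_neg (by omega), Nat.cast_sub (by omega)]
  push_cast; ring

lemma backwardTime_one (ha : 0 < a) (hj : j ≠ 0) : backwardTime a j xA yB 1 = 1 + xA := by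
  unfold backwardTime
  rw [if_pos (by omega), if_neg (by omega)]
  push_cast; ring

lemma backwardTime_after_branch (hj : j ≠ a) :
    backwardTime a j xA yB (a + 1) = 1 + yB := by
  unfold backwardTime
  rw [if_neg (by omega), if_neg (by omega)]
  push_cast; ring

/-- The expected time to reach `j` along a directed edge of `cycleChord n (a + 1)`. -/
def chordTime (n a j : ℕ) (xA yA zA xB yB zB : ℝ) : Fin n → Fin n → ℝ :=
  edgeTime (forwardTime n a j xB yA) (backwardTime a j xA yB) (1 + zB) (1 + zA)

lemma chordTime_target (ha : 2 ≤ a) (han : a + 1 < n) {j : Fin n}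
    (H : IsArrivalTimes n a j xA yA zA xB yB zB) (u : Fin n)
    (hu : (cycleChord n (a + 1)).Adj u j) : chordTime n a j xA yA zA xB yB zB u j = 1 := by
  obtain ⟨j, hj⟩ := j
  obtain ⟨u, hun⟩ := u
  have hA := H.eq_zero_left
  have hB := H.eq_zero_right
  rw [cycleChord_adj_iff ha han] at hu
  simp only at *
  unfold chordTime
  rcases hu with h | h | h | h
  · rw [h, edgeTime_next]
    simp only [cycleNext, Fin.mk.injEq] at h
    simp only
    unfold forwardTime
    split_ifs at h with h1
    · subst h
      rw [if_pos (Nat.lt_succ_self u)]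
      split_ifs <;> first | omega | (push_cast; ring)
    -- Here the edge runs from `n - 1` to the target `0`, so the vanishing of `yA` is needed.
    · obtain rfl : n = u + 1 := by omega
      rw [if_neg (by omega), if_neg (by omega), (hA h).2.1]
      push_cast; ring
  · rw [h, edgeTime_prev (by omega)]
    simp only [cyclePrev, Fin.mk.injEq] at h
    simp only
    unfold backwardTime
    split_ifs at h with h1
    · obtain rfl : n = j + 1 := by omega
      rw [if_pos h1, if_neg (by omega), if_pos (by omega)]
      push_cast; ring
    · obtain rfl : u = j + 1 := by omega
      rw [if_neg h1, if_pos (Nat.lt_succ_self j)]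
      split_ifs <;> first | omega | (push_cast; ring)
  · rw [edgeTime_chord_left ha han _ _ _ _ h.1 h.2, (hB h.2).2.2, add_zero]
  · rw [edgeTime_chord_right ha han _ _ _ _ h.1 h.2, (hA h.2).2.2, add_zero]

lemma chordTime_firstStep (ha : 2 ≤ a) (han : a + 1 < n) {j : Fin n}
    (H : IsArrivalTimes n a j xA yA zA xB yB zB) (u v : Fin n)
    (huv : (cycleChord n (a + 1)).Adj u v) (hvj : v ≠ j) :
    ∑ w ∈ (cycleChord n (a + 1)).neighborFinset v, chordTime n a j xA yA zA xB yB zB v w -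
      chordTime n a j xA yA zA xB yB zB v u =
      ((cycleChord n (a + 1)).degree v - 1) * (chordTime n a j xA yA zA xB yB zB u v - 1) := by
  have hA := H.left_eq
  have hB := H.right_eq
  have hjn := j.2
  have hvj' : (v : ℕ) ≠ j := fun h => hvj (Fin.ext h)
  rw [degree_cycleChord ha han]
  unfold chordTime
  rw [sum_edgeTime ha han]
  rw [cycleChord_adj_iff ha han] at huv
  rcases huv with h | h | h | h
  · have hu : u = cyclePrev v := by rw [h, cyclePrev_cycleNext]
    have e1 := edgeTime_next (forwardTime n a j xB yA) (backwardTime a j xA yB) (1 + zB)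
      (1 + zA) u
    rw [← h] at e1
    have e2 := edgeTime_prev (by omega) (forwardTime n a j xB yA) (backwardTime a j xA yB)
      (1 + zB) (1 + zA) v
    rw [← hu] at e2
    rw [e1, e2]
    have hu' := congrArg Fin.val hu
    simp only [cyclePrev] at hu'
    by_cases h0 : (v : ℕ) = 0
    · rw [if_pos h0] at hu'
      have h0a : (v : ℕ) ≠ a := by omega
      simp only [if_pos h0, if_neg h0a, hu']
      rw [forwardTime_last (by omega) hjn, h0]
      linarith [(hA (by omega)).2.1]
    · rw [if_neg h0] at hu'
      by_cases h1 : (v : ℕ) = a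
      · simp only [if_neg h0, if_pos h1, hu']
        rw [h1, forwardTime_before_branch (by omega) (by omega)]
        linarith [(hB (by omega)).1]
      · have hv : (v : ℕ) = u + 1 := by omega
        simp only [if_neg h0, if_neg h1]
        rw [forwardTime_succ (i := u) (by omega) (by omega), ← hv]
        ring
  · have hu : u = cycleNext v := by rw [h, cycleNext_cyclePrev]
    have e1 := edgeTime_prev (by omega) (forwardTime n a j xB yA) (backwardTime a j xA yB)
      (1 + zB) (1 + zA) u
    rw [← h] at e1
    have e2 := edgeTime_next (forwardTime n a j xB yA) (backwardTime a j xA yB) (1 + zB)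
      (1 + zA) v
    rw [← hu] at e2
    rw [e1, e2]
    have hu' := congrArg Fin.val hu
    simp only [cycleNext] at hu'
    -- In the labelling of backward moves, where `0` is read as `n`, the successor of `v` is always
    -- `v + 1`.
    have hu2 : (if (u : ℕ) = 0 then n else (u : ℕ)) = v + 1 := by
      split_ifs at hu' ⊢ <;> omega
    rw [hu2]
    by_cases h0 : (v : ℕ) = 0
    · have h0a : (v : ℕ) ≠ a := by omega
      simp only [if_pos h0, if_neg h0a]
      rw [h0, zero_add, backwardTime_one (by omega) (by omega)]
      linarith [(hA (by omega)).1]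
    · by_cases h1 : (v : ℕ) = a
      · simp only [if_neg h0, if_pos h1]
        rw [h1, backwardTime_after_branch (by omega)]
        linarith [(hB (by omega)).2.1]
      · simp only [if_neg h0, if_neg h1]
        rw [backwardTime_succ (i := v) (by omega) (by omega)]
        ring
  · rw [edgeTime_chord_left ha han _ _ _ _ h.1 h.2, edgeTime_chord_right ha han _ _ _ _ h.2 h.1]
    have h0 : (v : ℕ) ≠ 0 := by omega
    simp only [if_neg h0, if_pos h.2]
    rw [h.2]
    linarith [(hB (by omega)).2.2]
  · rw [edgeTime_chord_right ha han _ _ _ _ h.1 h.2, edgeTime_chord_left ha han _ _ _ _ h.2 h.1]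
    have h0 : (v : ℕ) ≠ a := by omega
    simp only [if_neg h0, if_pos h.2]
    rw [h.2]
    linarith [(hA (by omega)).2.2]

lemma chordTime_nonneg {j : ℕ} (H : IsArrivalTimes n a j xA yA zA xB yB zB) (u v : Fin n) :
    0 ≤ chordTime n a j xA yA zA xB yB zB u v := by
  obtain ⟨h1, h2, h3, h4, h5, h6⟩ := H.nonneg
  unfold chordTime edgeTime
  split_ifs
  · exact forwardTime_nonneg u.2.le h4 h2
  · exact backwardTime_nonneg h1 h5
  · exact backwardTime_nonneg h1 h5
  · positivity
  · positivity

/-- The sum of the expected times to reach `j` over the directed edges leaving `i`. -/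
def outTime (n a j : ℕ) (xA yA zA xB yB zB : ℝ) (i : ℕ) : ℝ :=
  forwardTime n a j xB yA i + backwardTime a j xA yB (if i = 0 then n else i) +
    (if i = 0 then 1 + zB else 0) + (if i = a then 1 + zA else 0)

theorem nbHittingTime_cycleChord (ha : 2 ≤ a) (han : a + 1 < n) {i j : Fin n} (hij : i ≠ j)
    (H : IsArrivalTimes n a j xA yA zA xB yB zB) :
    nbHittingTime (cycleChord n (a + 1)) i j ≠ ∞ ∧
      (cycleChord n (a + 1)).degree i * (nbHittingTime (cycleChord n (a + 1)) i j).toReal =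
        outTime n a j xA yA zA xB yB zB i := by
  have h := nbHittingTime_of_firstStep (two_le_degree_cycleChord ha han) hij _
    (chordTime_nonneg H) (chordTime_target ha han H) (chordTime_firstStep ha han H)
  rw [chordTime, sum_edgeTime ha han] at h
  exact h

end CycleChord

/-! ### Closed-form arrival times -/

section Kemeny

variable {n a j : ℕ} {xA yA zA xB yB zB : ℝ}

lemma isArrivalTimes_left_branch (ha : 0 < a) (han : a < n) :
    IsArrivalTimes n a 0 0 0 0 ((n - a + 1) / 2) ((a + 1) / 2) (n / 2) := by
  have h1 : (a : ℝ) < n := by exact_mod_cast han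
  have h2 : (0 : ℝ) < a := by exact_mod_cast ha
  refine ⟨⟨le_rfl, le_rfl, le_rfl, by linarith, by linarith, by linarith⟩,
    fun _ => ⟨rfl, rfl, rfl⟩, fun h => by omega, fun h => absurd rfl h, fun _ => ?_⟩
  have e1 : ∀ x y : ℝ, forwardTime n a 0 x y a = n - a + y := by
    intro x y; simp [forwardTime]
  have e2 : ∀ x y : ℝ, backwardTime a 0 x y a = a := by
    intro x y; simp [backwardTime, ha]
  rw [e1, e2]
  refine ⟨by ring, by ring, by ring⟩

lemma isArrivalTimes_right_branch (ha : 0 < a) (han : a < n) :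
    IsArrivalTimes n a a ((n - a + 1) / 2) ((a + 1) / 2) (n / 2) 0 0 0 := by
  have h1 : (a : ℝ) < n := by exact_mod_cast han
  have h2 : (0 : ℝ) < a := by exact_mod_cast ha
  refine ⟨⟨by linarith, by linarith, by linarith, le_rfl, le_rfl, le_rfl⟩,
    fun h => by omega, fun _ => ⟨rfl, rfl, rfl⟩, fun _ => ?_, fun h => absurd rfl h⟩
  have e1 : ∀ x y : ℝ, forwardTime n a a x y 0 = a := by
    intro x y; simp [forwardTime, ha]
  have e2 : ∀ x y : ℝ, backwardTime a a x y n = n - a := by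
    intro x y; simp [backwardTime, han, not_le.2 han]
  rw [e1, e2]
  refine ⟨by ring, by ring, by ring⟩

/-- The reflection exchanging the branch vertices replaces `j` by `a - j` and swaps the `A` and `B`
values. Exchanging the two long paths gives the companion solution for `a < j`. -/
lemma isArrivalTimes_left_path (h0 : 0 < j) (hja : j < a) (han : a < n) :
    IsArrivalTimes n a j ((n - a + 1) + (2 * a - j) / 3) ((j + n + 2) / 3)
      ((j + a + 1 + 2 * (n - a)) / 3) ((n - a + 1) + (a + j) / 3) ((a - j + n + 2) / 3)
      ((a - j + a + 1 + 2 * (n - a)) / 3) := by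
  have h1 : (a : ℝ) < n := by exact_mod_cast han
  have h2 : (j : ℝ) < a := by exact_mod_cast hja
  have h3 : (0 : ℝ) < j := by exact_mod_cast h0
  refine ⟨⟨by linarith, by linarith, by linarith, by linarith, by linarith, by linarith⟩,
    fun h => by omega, fun h => by omega, fun _ => ?_, fun _ => ?_⟩
  · have e1 : ∀ x y : ℝ, forwardTime n a j x y 0 = j := by
      intro x y; simp [forwardTime, h0, h0.trans hja, hja.le]
    have e2 : ∀ x y : ℝ, backwardTime a j x y n = n - a + y := by
      intro x y; simp [backwardTime, not_le.2 han, not_le.2 hja]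
    rw [e1, e2]
    refine ⟨by ring, by ring, by ring⟩
  · have e1 : ∀ x y : ℝ, forwardTime n a j x y a = n - a + y := by
      intro x y; simp [forwardTime, hja.le]
    have e2 : ∀ x y : ℝ, backwardTime a j x y a = a - j := by
      intro x y; simp [backwardTime, hja]
    rw [e1, e2]
    refine ⟨by ring, by ring, by ring⟩

lemma isArrivalTimes_right_path (haj : a < j) (hjn : j < n) (ha : 0 < a) :
    IsArrivalTimes n a j ((n - j + n + 2) / 3) ((a + 1) + (2 * (n - a) - (n - j)) / 3)
      ((n - j + (n - a) + 1 + 2 * a) / 3) ((j - a + n + 2) / 3)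
      ((a + 1) + (2 * (n - a) - (j - a)) / 3) ((j - a + (n - a) + 1 + 2 * a) / 3) := by
  have h1 : (a : ℝ) < j := by exact_mod_cast haj
  have h2 : (j : ℝ) < n := by exact_mod_cast hjn
  have h3 : (0 : ℝ) < a := by exact_mod_cast ha
  refine ⟨⟨by linarith, by linarith, by linarith, by linarith, by linarith, by linarith⟩,
    fun h => by omega, fun h => by omega, fun _ => ?_, fun _ => ?_⟩
  · have e1 : ∀ x y : ℝ, forwardTime n a j x y 0 = a + x := by
      intro x y; simp [forwardTime, ha, not_le.2 haj]
    have e2 : ∀ x y : ℝ, backwardTime a j x y n = n - j := by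
      intro x y; simp [backwardTime, not_le.2 (haj.trans hjn), haj.le, hjn]
    rw [e1, e2]
    refine ⟨by ring, by ring, by ring⟩
  · have e1 : ∀ x y : ℝ, forwardTime n a j x y a = j - a := by
      intro x y; simp [forwardTime, haj]
    have e2 : ∀ x y : ℝ, backwardTime a j x y a = a + x := by
      intro x y; simp [backwardTime, haj.le]
    rw [e1, e2]
    refine ⟨by ring, by ring, by ring⟩

lemma exists_isArrivalTimes (ha : 2 ≤ a) (han : a + 1 < n) (hj : j < n) :
    ∃ xA yA zA xB yB zB, IsArrivalTimes n a j xA yA zA xB yB zB := by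
  rcases Nat.eq_zero_or_pos j with rfl | h0
  · exact ⟨_, _, _, _, _, _, isArrivalTimes_left_branch (by omega) (by omega)⟩
  rcases lt_trichotomy j a with h | rfl | h
  · exact ⟨_, _, _, _, _, _, isArrivalTimes_left_path h0 h (by omega)⟩
  · exact ⟨_, _, _, _, _, _, isArrivalTimes_right_branch (by omega) (by omega)⟩
  · exact ⟨_, _, _, _, _, _, isArrivalTimes_right_path h hj (by omega)⟩

/-! ### Column sums of the hitting-time matrix -/

lemma sum_range_quadratic (x y z : ℝ) (m : ℕ) :
    ∑ i ∈ Finset.range m, (x + y * i + z * (i : ℝ) ^ 2) =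
      m * x + y * (m * (m - 1) / 2) + z * (m * (m - 1) * (2 * m - 1) / 6) := by
  induction m with
  | zero => simp
  | succ m ih => rw [Finset.sum_range_succ, ih]; push_cast; ring

lemma sum_range_of_linear {f : ℕ → ℝ} {m : ℕ} (x y : ℝ) (h : ∀ i < m, f i = x + y * i) :
    ∑ i ∈ Finset.range m, f i = m * x + y * (m * (m - 1) / 2) := by
  have h2 := sum_range_quadratic x y 0 m
  rw [zero_mul, add_zero] at h2
  rw [← h2]
  refine Finset.sum_congr rfl fun i hi => ?_
  rw [h i (Finset.mem_range.1 hi)]; ring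

lemma sum_forwardTime_left (hja : j ≤ a) (han : a ≤ n) :
    ∑ i ∈ Finset.range n, forwardTime n a j xB yA i =
      j * (j + 1) / 2 + (a - j) * (a - j + 1) / 2 + (a - j) * xB +
        (n - a) * (n - a + 1) / 2 + (n - a) * yA := by
  obtain ⟨p, rfl⟩ := Nat.exists_eq_add_of_le hja
  obtain ⟨q, rfl⟩ := Nat.exists_eq_add_of_le han
  rw [Finset.sum_range_add, Finset.sum_range_add,
    sum_range_of_linear (j : ℝ) (-1) (fun i hi => ?_),
    sum_range_of_linear (p + xB : ℝ) (-1) (fun i hi => ?_),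
    sum_range_of_linear (q + yA : ℝ) (-1) (fun i hi => ?_)]
  · push_cast; ring
  all_goals unfold forwardTime; split_ifs <;> first | omega | (push_cast; ring)

lemma sum_forwardTime_right (haj : a < j) (hjn : j ≤ n) :
    ∑ i ∈ Finset.range n, forwardTime n a j xB yA i =
      a * (a + 1) / 2 + a * xB + (j - a) * (j - a + 1) / 2 +
        (n - j) * (n - j + 1) / 2 + (n - j) * yA := by
  obtain ⟨p, rfl⟩ := Nat.exists_eq_add_of_le haj.le
  obtain ⟨q, rfl⟩ := Nat.exists_eq_add_of_le hjn
  rw [Finset.sum_range_add, Finset.sum_range_add,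
    sum_range_of_linear (a + xB : ℝ) (-1) (fun i hi => ?_),
    sum_range_of_linear (p : ℝ) (-1) (fun i hi => ?_),
    sum_range_of_linear (q + yA : ℝ) (-1) (fun i hi => ?_)]
  · push_cast; ring
  all_goals unfold forwardTime; split_ifs <;> first | omega | (push_cast; ring)

/-- Reading `0` as `n` makes the backward labels run through `1, …, n`. -/
lemma sum_backwardTime_cyclic :
    ∑ i ∈ Finset.range n, backwardTime a j xA yB (if i = 0 then n else i) =
      ∑ i ∈ Finset.range n, backwardTime a j xA yB (i + 1) := by
  cases n with
  | zero => simp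
  | succ m =>
    rw [Finset.sum_range_succ', Finset.sum_range_succ]
    simp

lemma sum_backwardTime_left (hja : j ≤ a) (han : a ≤ n) (h : j = a → yB = 0) :
    ∑ i ∈ Finset.range n, backwardTime a j xA yB (i + 1) =
      j * (j + 1) / 2 + j * xA + (a - j) * (a - j + 1) / 2 +
        (n - a) * (n - a + 1) / 2 + (n - a) * yB := by
  obtain ⟨p, rfl⟩ := Nat.exists_eq_add_of_le hja
  obtain ⟨q, rfl⟩ := Nat.exists_eq_add_of_le han
  -- For `p = 0` the target is `a` itself and `backwardTime` takes its direct branch; the formula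
  -- with `yB` agrees only because `yB = 0`.
  have e : ∀ i < q, backwardTime (j + p) j xA yB (j + p + i + 1) = 1 + yB + 1 * i := by
    intro i _
    rcases Nat.eq_zero_or_pos p with rfl | hp
    · rw [h rfl]
      unfold backwardTime
      split_ifs <;> first | omega | (push_cast; ring)
    · unfold backwardTime
      split_ifs <;> first | omega | (push_cast; ring)
  rw [Finset.sum_range_add, Finset.sum_range_add,
    sum_range_of_linear (1 + xA : ℝ) 1 (fun i hi => ?_),
    sum_range_of_linear (1 : ℝ) 1 (fun i hi => ?_), sum_range_of_linear (1 + yB : ℝ) 1 e]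
  · push_cast; ring
  all_goals unfold backwardTime; split_ifs <;> first | omega | (push_cast; ring)

lemma sum_backwardTime_right (haj : a < j) (hjn : j ≤ n) :
    ∑ i ∈ Finset.range n, backwardTime a j xA yB (i + 1) =
      a * (a + 1) / 2 + a * xA + (j - a) * (j - a + 1) / 2 + (j - a) * yB +
        (n - j) * (n - j + 1) / 2 := by
  obtain ⟨p, rfl⟩ := Nat.exists_eq_add_of_le haj.le
  obtain ⟨q, rfl⟩ := Nat.exists_eq_add_of_le hjn
  rw [Finset.sum_range_add, Finset.sum_range_add,
    sum_range_of_linear (1 + xA : ℝ) 1 (fun i hi => ?_),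
    sum_range_of_linear (1 + yB : ℝ) 1 (fun i hi => ?_),
    sum_range_of_linear (1 : ℝ) 1 (fun i hi => ?_)]
  · push_cast; ring
  all_goals unfold backwardTime; split_ifs <;> first | omega | (push_cast; ring)

/-- The sum of `deg i * (M i j)` over all vertices `i`. -/
def columnTotal (n a j : ℕ) (xA yA zA xB yB zB : ℝ) : ℝ :=
  ∑ i ∈ Finset.range n, outTime n a j xA yA zA xB yB zB i - outTime n a j xA yA zA xB yB zB j

lemma sum_outTime (ha : 0 < a) (han : a < n) :
    ∑ i ∈ Finset.range n, outTime n a j xA yA zA xB yB zB i =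
      ∑ i ∈ Finset.range n, forwardTime n a j xB yA i +
        ∑ i ∈ Finset.range n, backwardTime a j xA yB (i + 1) + (2 + zA + zB) := by
  simp only [outTime, Finset.sum_add_distrib]
  rw [sum_backwardTime_cyclic, Finset.sum_ite_eq', Finset.sum_ite_eq',
    if_pos (by simp; omega), if_pos (by simp; omega)]
  ring

lemma columnTotal_left (hja : j ≤ a) (ha : 0 < a) (han : a < n) (h : j = a → yB = 0) :
    columnTotal n a j xA yA zA xB yB zB =
      j * (j + 1) + (a - j) * (a - j + 1) + (a - j) * xB + (n - a) * (n - a + 1) + (n - a) * yA +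
        j * xA + (n - a) * yB + 2 + zA + zB - outTime n a j xA yA zA xB yB zB j := by
  rw [columnTotal, sum_outTime ha han, sum_forwardTime_left hja han.le,
    sum_backwardTime_left hja han.le h]
  ring

lemma columnTotal_left_branch (ha : 0 < a) (han : a < n) :
    columnTotal n a 0 0 0 0 ((n - a + 1) / 2) ((a + 1) / 2) (n / 2) =
      (a : ℝ) ^ 2 + a * (n - a) + (n - a : ℝ) ^ 2 := by
  rw [columnTotal_left (Nat.zero_le _) ha han (fun h => by omega)]
  simp [outTime, forwardTime, backwardTime, ha, ha.ne, not_le.2 han, ha.ne']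
  ring

lemma columnTotal_right_branch (ha : 0 < a) (han : a < n) :
    columnTotal n a a ((n - a + 1) / 2) ((a + 1) / 2) (n / 2) 0 0 0 =
      (a : ℝ) ^ 2 + a * (n - a) + (n - a : ℝ) ^ 2 := by
  rw [columnTotal_left le_rfl ha han (fun _ => rfl)]
  simp only [outTime, forwardTime, backwardTime, ha.ne', lt_irrefl, le_refl, if_true, if_false]
  ring

lemma columnTotal_left_path (h0 : 0 < j) (hja : j < a) (han : a < n) :
    columnTotal n a j xA yA zA xB yB zB =
      j * (j + 1) + (a - j) * (a - j + 1) + (a - j) * xB + (n - a) * (n - a + 1) + (n - a) * yA +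
        j * xA + (n - a) * yB + 2 + zA + zB - (a + xB + xA) := by
  have e1 : forwardTime n a j xB yA j = a - j + xB := by
    simp [forwardTime, hja]
  have e2 : backwardTime a j xA yB j = j + xA := by
    simp [backwardTime, hja.le]
  rw [columnTotal_left hja.le (by omega) han (fun h => by omega), outTime,
    if_neg h0.ne', if_neg h0.ne', if_neg hja.ne, e1, e2]
  ring

lemma columnTotal_right_path (haj : a < j) (hjn : j < n) (ha : 0 < a) :
    columnTotal n a j xA yA zA xB yB zB =
      a * (a + 1) + (j - a) * (j - a + 1) + (n - j) * (n - j + 1) + a * xB + (n - j) * yA +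
        a * xA + (j - a) * yB + 2 + zA + zB - (n - a + yA + yB) := by
  have e1 : forwardTime n a j xB yA j = n - j + yA := by
    simp [forwardTime, not_lt.2 haj.le]
  have e2 : backwardTime a j xA yB j = j - a + yB := by
    simp [backwardTime, not_le.2 haj]
  rw [columnTotal, sum_outTime ha (by omega), sum_forwardTime_right haj hjn.le,
    sum_backwardTime_right haj hjn.le, outTime,
    if_neg (by omega), if_neg (by omega), if_neg haj.ne', e1, e2]
  ring

lemma sum_nbHittingMatrix_column (ha : 2 ≤ a) (han : a + 1 < n) (j : Fin n)
    (H : IsArrivalTimes n a j xA yA zA xB yB zB) :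
    ∑ i, ((cycleChord n (a + 1)).degree i : ℝ) * nbHittingMatrix (cycleChord n (a + 1)) i j =
      columnTotal n a j xA yA zA xB yB zB := by
  -- At `i = j` the matrix entry is `0`, whereas `outTime` sums the times to return to `j`; this
  -- term must be removed.
  have e : ∀ i : Fin n, ((cycleChord n (a + 1)).degree i : ℝ) *
      nbHittingMatrix (cycleChord n (a + 1)) i j =
      outTime n a j xA yA zA xB yB zB i - if i = j then outTime n a j xA yA zA xB yB zB j else 0 := by
    intro i
    by_cases hij : i = j
    · subst hij
      simp [nbHittingMatrix]
    · rw [if_neg hij, sub_zero, ← (nbHittingTime_cycleChord ha han hij H).2]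
      simp [nbHittingMatrix, hij]
  simp only [e, Finset.sum_sub_distrib, Finset.sum_ite_eq', Finset.mem_univ, if_true]
  rw [Fin.sum_univ_eq_sum_range (fun i => outTime n a j xA yA zA xB yB zB i) n, columnTotal]

/-! ### Kemeny's constant and its monotonicity -/

/-- The weight `deg j` is two plus one at each branch vertex, hence the extra terms `T 0` and `T a`.
-/
lemma nbKemeny_eq_sum (ha : 2 ≤ a) (han : a + 1 < n) (T : ℕ → ℝ)
    (hT : ∀ j : Fin n, ∑ i, ((cycleChord n (a + 1)).degree i : ℝ) *
      nbHittingMatrix (cycleChord n (a + 1)) i j = T j) :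
    nbKemeny (cycleChord n (a + 1)) =
      (2 * ∑ j ∈ Finset.range n, T j + T 0 + T a) / (2 * (n + 1)) ^ 2 := by
  have h1 : 2 * ∑ j ∈ Finset.range n, T j + T 0 + T a =
      ∑ j : Fin n, T j * (cycleChord n (a + 1)).degree j := by
    simp only [degree_cycleChord ha han]
    rw [Fin.sum_univ_eq_sum_range (fun j => T j * (2 + (if j = 0 then (1 : ℝ) else 0) +
      (if j = a then 1 else 0))) n]
    simp only [mul_add, Finset.sum_add_distrib, mul_ite, mul_one, mul_zero]
    rw [Finset.sum_ite_eq', Finset.sum_ite_eq', if_pos (by simp; omega), if_pos (by simp; omega),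
      ← Finset.sum_mul]
    ring
  rw [h1]
  simp only [← hT, nbKemeny, dotProduct, Matrix.mulVec, statDist,
    two_mul_card_edgeFinset_cycleChord ha han, Finset.mul_sum, Finset.sum_mul, Finset.sum_div]
  rw [Finset.sum_comm]
  refine Finset.sum_congr rfl fun j _ => Finset.sum_congr rfl fun i _ => ?_
  field_simp

/-- The value of `columnTotal` at the arrival times of `cycleChord n (a + 1)`. -/
noncomputable def columnValue (n a j : ℕ) : ℝ :=
  if j = 0 ∨ j = a then (a : ℝ) ^ 2 + a * (n - a) + (n - a : ℝ) ^ 2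
  else if j < a then 4 / 3 * a ^ 2 + a + 2 * a * (n - a) + 5 / 3 * (n - a : ℝ) ^ 2 +
    5 / 3 * (n - a) + 2 / 3 - 4 / 3 * j * (a - j)
  else 4 / 3 * (n - a : ℝ) ^ 2 + (n - a) + 2 * a * (n - a) + 5 / 3 * a ^ 2 + 5 / 3 * a + 2 / 3 -
    4 / 3 * (j - a) * (n - j)

lemma sum_nbHittingMatrix_column_eq (ha : 2 ≤ a) (han : a + 1 < n) (j : Fin n) :
    ∑ i, ((cycleChord n (a + 1)).degree i : ℝ) * nbHittingMatrix (cycleChord n (a + 1)) i j =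
      columnValue n a j := by
  unfold columnValue
  split_ifs with h1 h2
  · rcases h1 with h1 | h1
    · have H : IsArrivalTimes n a j 0 0 0 ((n - a + 1) / 2) ((a + 1) / 2) (n / 2) := by
        rw [h1]; exact isArrivalTimes_left_branch (by omega) (by omega)
      rw [sum_nbHittingMatrix_column ha han j H, h1,
        columnTotal_left_branch (by omega) (by omega)]
    · have H : IsArrivalTimes n a j ((n - a + 1) / 2) ((a + 1) / 2) (n / 2) 0 0 0 := by
        rw [h1]; exact isArrivalTimes_right_branch (by omega) (by omega)
      rw [sum_nbHittingMatrix_column ha han j H, h1,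
        columnTotal_right_branch (by omega) (by omega)]
  · rw [sum_nbHittingMatrix_column ha han j
      (isArrivalTimes_left_path (by omega) h2 (by omega)),
      columnTotal_left_path (by omega) h2 (by omega)]
    ring
  · rw [sum_nbHittingMatrix_column ha han j
      (isArrivalTimes_right_path (by omega) j.2 (by omega)),
      columnTotal_right_path (by omega) j.2 (by omega)]
    ring

lemma sum_range_of_quadratic {f : ℕ → ℝ} {m : ℕ} (x y z : ℝ)
    (h : ∀ i < m, f i = x + y * i + z * (i : ℝ) ^ 2) :
    ∑ i ∈ Finset.range m, f i =
      m * x + y * (m * (m - 1) / 2) + z * (m * (m - 1) * (2 * m - 1) / 6) := by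
  rw [← sum_range_quadratic]
  exact Finset.sum_congr rfl fun i hi => h i (Finset.mem_range.1 hi)

/-- Two branch vertices, `a - 1` and `n - a - 1` inner vertices. The subtracted cubics come from `∑
j (m - j) = (m - 1) m (m + 1) / 6` over `0 < j < m`, for `m = a` and `m = n - a`. -/
lemma sum_columnValue (ha : 0 < a) (han : a < n) :
    ∑ j ∈ Finset.range n, columnValue n a j =
      2 * ((a : ℝ) ^ 2 + a * (n - a) + (n - a : ℝ) ^ 2) +
      (a - 1) * (4 / 3 * a ^ 2 + a + 2 * a * (n - a) + 5 / 3 * (n - a : ℝ) ^ 2 +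
        5 / 3 * (n - a) + 2 / 3) +
      (n - a - 1) * (4 / 3 * (n - a : ℝ) ^ 2 + (n - a) + 2 * a * (n - a) + 5 / 3 * a ^ 2 +
        5 / 3 * a + 2 / 3) -
      2 / 9 * (a - 1) * a * (a + 1) - 2 / 9 * (n - a - 1) * (n - a) * (n - a + 1) := by
  -- `p = a - 1` and `q = n - a - 1` count the inner vertices of the two paths.
  obtain ⟨p, rfl⟩ := Nat.exists_eq_add_of_lt ha
  obtain ⟨q, rfl⟩ := Nat.exists_eq_add_of_lt han
  rw [zero_add, show p + 1 + q + 1 = p + 1 + 1 + q by ring]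
  set N := p + 1 + 1 + q with hN
  have hNq : (N : ℝ) = p + 1 + 1 + q := by rw [hN]; push_cast; ring
  have e0 : columnValue N (p + 1) 0 = ((p + 1 : ℕ) : ℝ) ^ 2 + (p + 1 : ℕ) * (N - (p + 1 : ℕ)) +
      (N - (p + 1 : ℕ) : ℝ) ^ 2 := by
    rw [columnValue, if_pos (Or.inl rfl)]
  have ea : columnValue N (p + 1) (p + 1) = ((p + 1 : ℕ) : ℝ) ^ 2 +
      (p + 1 : ℕ) * (N - (p + 1 : ℕ)) + (N - (p + 1 : ℕ) : ℝ) ^ 2 := by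
    rw [columnValue, if_pos (Or.inr rfl)]
  have h1 := sum_range_of_quadratic (f := fun i => columnValue N (p + 1) (i + 1)) (m := p)
    (4 / 3 * (p + 1) ^ 2 + (p + 1) + 2 * (p + 1) * (q + 1) + 5 / 3 * (q + 1) ^ 2 +
      5 / 3 * (q + 1) + 2 / 3 - 4 / 3 * p) (4 / 3 * (1 - p)) (4 / 3) (fun i hi => by
        rw [columnValue, if_neg (by omega), if_pos (by omega), hNq]
        push_cast; ring)
  have h2 := sum_range_of_quadratic (f := fun i => columnValue N (p + 1) (p + 1 + 1 + i)) (m := q)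
    (4 / 3 * (q + 1) ^ 2 + (q + 1) + 2 * (p + 1) * (q + 1) + 5 / 3 * (p + 1) ^ 2 +
      5 / 3 * (p + 1) + 2 / 3 - 4 / 3 * q) (4 / 3 * (1 - q)) (4 / 3) (fun i hi => by
        rw [columnValue, if_neg (by omega), if_neg (by omega), hNq]
        push_cast; ring)
  rw [Finset.sum_range_add, Finset.sum_range_succ, Finset.sum_range_succ', h1, h2, e0, ea, hNq]
  push_cast; ring

theorem nbKemeny_cycleChord {k : ℕ} (hk : 3 ≤ k) (hkn : k < n) :
    nbKemeny (cycleChord n k) =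
      (10 * (n : ℝ) ^ 3 + (n : ℝ) ^ 2 * (3 * (k : ℝ) + 6)
        - (n : ℝ) * (3 * (k : ℝ) ^ 2 - 9 * (k : ℝ) + 22)
        - 3 * (k : ℝ) ^ 2 + 6 * (k : ℝ) - 15) / (18 * ((n : ℝ) + 1) ^ 2) := by
  obtain ⟨a, rfl⟩ : ∃ a, k = a + 1 := ⟨k - 1, by omega⟩
  have ha : 2 ≤ a := by omega
  rw [nbKemeny_eq_sum ha hkn (columnValue n a) (sum_nbHittingMatrix_column_eq ha hkn),
    sum_columnValue (by omega) (by omega)]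
  have e0 : columnValue n a 0 = (a : ℝ) ^ 2 + a * (n - a) + (n - a : ℝ) ^ 2 := by
    rw [columnValue, if_pos (Or.inl rfl)]
  have ea : columnValue n a a = (a : ℝ) ^ 2 + a * (n - a) + (n - a : ℝ) ^ 2 := by
    rw [columnValue, if_pos (Or.inr rfl)]
  have hn : (n : ℝ) + 1 ≠ 0 := by positivity
  rw [e0, ea]
  push_cast
  field_simp
  ring

theorem nbHittingTime_cycleChord_ne_top {k : ℕ} (hk : 3 ≤ k) (hkn : k < n) (i j : Fin n) :
    nbHittingTime (cycleChord n k) i j ≠ ∞ := by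
  obtain ⟨a, rfl⟩ : ∃ a, k = a + 1 := ⟨k - 1, by omega⟩
  by_cases hij : i = j
  · rw [hij, nbHittingTime_self]
    exact ENNReal.zero_ne_top
  · obtain ⟨xA, yA, zA, xB, yB, zB, H⟩ :=
      exists_isArrivalTimes (a := a) (by omega) hkn j.2
    exact (nbHittingTime_cycleChord (by omega) hkn hij H).1

lemma nbKemeny_cycleChord_lt {k l : ℕ} (hk : 3 ≤ k) (hkl : k < l) (hl : 2 * l ≤ n) :
    nbKemeny (cycleChord n k) < nbKemeny (cycleChord n l) := by
  rw [nbKemeny_cycleChord hk (by omega), nbKemeny_cycleChord (by omega) (by omega)]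
  refine div_lt_div_of_pos_right ?_ (by positivity)
  have h1 : (k : ℝ) + 1 ≤ l := by exact_mod_cast hkl
  have h2 : 2 * (l : ℝ) ≤ n := by exact_mod_cast hl
  have h3 : (0 : ℝ) ≤ n := by positivity
  have h4 : 0 ≤ n * ((n : ℝ) - k - l) := mul_nonneg h3 (by linarith)
  -- Three times this product is the difference of the two numerators; `k < l ≤ n / 2` gives `k + l
  -- < n`, which makes the second factor positive.
  have h5 : 0 < ((l : ℝ) - k) * (n * (n - k - l) + 3 * n - (k + l) + 2) :=
    mul_pos (by linarith) (by linarith)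
  linarith

end Kemeny

theorem mainTheorem7 (n : ℕ) :
    (∀ k : ℕ, 3 ≤ k → k < n →
      (∀ i j : Fin n, nbHittingTime (cycleChord n k) i j ≠ ∞) ∧
      nbKemeny (cycleChord n k) =
        (10 * (n : ℝ) ^ 3 + (n : ℝ) ^ 2 * (3 * (k : ℝ) + 6)
            - (n : ℝ) * (3 * (k : ℝ) ^ 2 - 9 * (k : ℝ) + 22)
            - 3 * (k : ℝ) ^ 2 + 6 * (k : ℝ) - 15) / (18 * ((n : ℝ) + 1) ^ 2)) ∧
    StrictMonoOn (fun k : ℕ => nbKemeny (cycleChord n k)) {k : ℕ | 3 ≤ k ∧ 2 * k ≤ n} := by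
  exact ⟨fun k hk hkn => ⟨nbHittingTime_cycleChord_ne_top hk hkn, nbKemeny_cycleChord hk hkn⟩,
    fun k hk l hl hkl => nbKemeny_cycleChord_lt hk.1 hkl hl.2⟩
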